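/- For $n\ge 0$ let $\mathcal O_n$ be the monoid of order-preserving maps $\{0,\dots,n-1\}\to\{0,\dots,n-1\}$ (the endomorphisms of $n$ in the simplicial category $\Delta$) under composition $(\varphi\circ\psi)(j)=\varphi(\psi(j))$. For $0\le i\le n-2$ let $p^i\in\mathcal O_n$ be the map that sends $i+1$ to $i$ and fixes every other point, and let $q^i\in\mathcal O_n$ be the map that sends $i$ to $i+1$ and fixes every other point. For $m\ge 0$ define three monoids by generators and relations. Each of them has generators $h^i$ for $1\le i\le m-1$ (among others) that satisfy $h^i\circ h^j=h^j\circ h^i$ for $j+1<i$ and $h^i\circ h^{i\pm1}\circ h^i=h^i$. - $\mathcal K_m$ has one further generator $c$, and the further relations $h^i\circ c=c\circ h^i$ and $h^i\circ h^i=c\circ h^i$. - $\mathcal J_m$ has one further generator $c$, and the further relations $c=\mathbf 1$ and $h^i\circ h^i=h^i$. - $\mathcal L_m$ has further generators $c_k^{\alpha}$ for $1\le k\le m+1$ and ordinals $\alpha<\varepsilon_0$, and the further relations $c_k^{0}=\mathbf 1$; $c_k^{\alpha}\circ c_k^{\beta}=c_k^{\alpha\sharp\beta}$, where $\sharp$ is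 the natural (Hessenberg) sum; $c_k^{\alpha}\circ c_l^{\beta}=c_l^{\beta}\circ c_k^{\alpha}$ for $k\ne l$; $h^i\circ c_k^{\alpha}=c_k^{\alpha}\circ h^i$ for $k\ne i+1$; $h^i\circ c_{i+1}^{\alpha}\circ h^i=c_i^{\omega^{\alpha}}\circ h^i$; and $c_i^{\alpha}\circ h^i=c_{i+2}^{\alpha}\circ h^i$. Then for every $n\ge 0$ the monoid $\mathcal O_n$ is isomorphic to a submonoid of each of $\mathcal K_{2n}$, $\mathcal L_{2n}$ and $\mathcal J_{2n}$. More precisely, for each $\mathcal M\in\{\mathcal K_{2n},\mathcal L_{2n},\mathcal J_{2n}\}$ there is an injective monoid homomorphism $f:\mathcal O_n\to\mathcal M$ such that, for all $0\le i\le n-2$, $$f(p^i)=h^{2i+3}\circ h^{2i+2},\qquad f(q^i)=h^{2i+1}\circ h^{2i+2}.$$ -/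

import Mathlib

namespace TemperleyLieb

open FreeMonoid (of)

/-! ### The monoid of simplicial endomorphisms -/

/-- The monoid of endomorphisms of the object `n = {0, …, n - 1}` of the simplicial category:
the order-preserving maps of `Fin n` to itself, with `(φ * ψ) j = φ (ψ j)`. -/
abbrev O (n : ℕ) : Type := Fin n →o Fin n

/-- The right-forking endomorphism `p^i`: it maps `i + 1` to `i` and fixes all other points. -/
def O.p {n : ℕ} (i : ℕ) (hi : i + 2 ≤ n) : O n where
  toFun j := if j.val = i + 1 then ⟨i, by omega⟩ else j
  monotone' := by
    intro a b hab
    have hab' : a.val ≤ b.val := hab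
    rw [Fin.le_def]
    dsimp only
    split_ifs <;> grind

/-- The left-forking endomorphism `q^i`: it maps `i` to `i + 1` and fixes all other points. -/
def O.q {n : ℕ} (i : ℕ) (hi : i + 2 ≤ n) : O n where
  toFun j := if j.val = i then ⟨i + 1, by omega⟩ else j
  monotone' := by
    intro a b hab
    have hab' : a.val ≤ b.val := hab
    rw [Fin.le_def]
    dsimp only
    split_ifs <;> grind

/-! ### The monoids `K_n` and `J_n` -/

/-- The generators of `K_n` and `J_n`: `h^i` for `1 ≤ i ≤ n - 1`, and the circle `c`. -/
inductive Gen (n : ℕ) : Type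
  | h (i : ℕ) (h1 : 1 ≤ i) (hn : i < n) : Gen n
  | c : Gen n

/-- The defining equations of `K_n`. -/
inductive KRel (n : ℕ) : FreeMonoid (Gen n) → FreeMonoid (Gen n) → Prop
  | comm (i j : ℕ) (hi1 : 1 ≤ i) (hin : i < n) (hj1 : 1 ≤ j) (hjn : j < n) (hji : j + 1 < i) :
      KRel n (of (.h i hi1 hin) * of (.h j hj1 hjn)) (of (.h j hj1 hjn) * of (.h i hi1 hin))
  | up (i : ℕ) (hi1 : 1 ≤ i) (hin : i < n) (hj1 : 1 ≤ i + 1) (hjn : i + 1 < n) :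
      KRel n (of (.h i hi1 hin) * of (.h (i + 1) hj1 hjn) * of (.h i hi1 hin))
        (of (.h i hi1 hin))
  | down (i : ℕ) (hi1 : 1 ≤ i) (hin : i < n) (hj1 : 1 ≤ i + 1) (hjn : i + 1 < n) :
      KRel n (of (.h (i + 1) hj1 hjn) * of (.h i hi1 hin) * of (.h (i + 1) hj1 hjn))
        (of (.h (i + 1) hj1 hjn))
  | circle_comm (i : ℕ) (hi1 : 1 ≤ i) (hin : i < n) :
      KRel n (of (.h i hi1 hin) * of .c) (of .c * of (.h i hi1 hin))
  | circle (i : ℕ) (hi1 : 1 ≤ i) (hin : i < n) :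
      KRel n (of (.h i hi1 hin) * of (.h i hi1 hin)) (of .c * of (.h i hi1 hin))

/-- The monoid `K_n`. -/
abbrev K (n : ℕ) : Type := PresentedMonoid (KRel n)

/-- The element `h^i` of `K_n`. -/
def K.h {n : ℕ} (i : ℕ) (h1 : 1 ≤ i) (hn : i < n) : K n := PresentedMonoid.of (KRel n) (.h i h1 hn)

/-- The defining equations of `J_n`: circles are ignored. -/
inductive JRel (n : ℕ) : FreeMonoid (Gen n) → FreeMonoid (Gen n) → Prop
  | comm (i j : ℕ) (hi1 : 1 ≤ i) (hin : i < n) (hj1 : 1 ≤ j) (hjn : j < n) (hji : j + 1 < i) :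
      JRel n (of (.h i hi1 hin) * of (.h j hj1 hjn)) (of (.h j hj1 hjn) * of (.h i hi1 hin))
  | up (i : ℕ) (hi1 : 1 ≤ i) (hin : i < n) (hj1 : 1 ≤ i + 1) (hjn : i + 1 < n) :
      JRel n (of (.h i hi1 hin) * of (.h (i + 1) hj1 hjn) * of (.h i hi1 hin))
        (of (.h i hi1 hin))
  | down (i : ℕ) (hi1 : 1 ≤ i) (hin : i < n) (hj1 : 1 ≤ i + 1) (hjn : i + 1 < n) :
      JRel n (of (.h (i + 1) hj1 hjn) * of (.h i hi1 hin) * of (.h (i + 1) hj1 hjn))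
        (of (.h (i + 1) hj1 hjn))
  | circle_one : JRel n (of .c) 1
  | idem (i : ℕ) (hi1 : 1 ≤ i) (hin : i < n) :
      JRel n (of (.h i hi1 hin) * of (.h i hi1 hin)) (of (.h i hi1 hin))

/-- The monoid `J_n`. -/
abbrev J (n : ℕ) : Type := PresentedMonoid (JRel n)

/-- The element `h^i` of `J_n`. -/
def J.h {n : ℕ} (i : ℕ) (h1 : 1 ≤ i) (hn : i < n) : J n := PresentedMonoid.of (JRel n) (.h i h1 hn)

/-! ### The monoid `L_n` -/

open Ordinal

/-- The natural (Hessenberg) sum of ordinals: the least ordinal above all `natSum a' b` with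
`a' < a` and all `natSum a b'` with `b' < b`. -/
noncomputable def natSum (a b : Ordinal.{0}) : Ordinal.{0} :=
  max (⨆ x : Set.Iio a, Order.succ (natSum x.1 b)) (⨆ x : Set.Iio b, Order.succ (natSum a x.1))
termination_by (a, b)
decreasing_by
  · exact Prod.Lex.left _ _ x.2
  · exact Prod.Lex.right _ x.2

/-- The generators of `L_n`: `h^i` for `1 ≤ i ≤ n - 1`, and `c_k^α` for `1 ≤ k ≤ n + 1` and ordinals
`α < ε₀`. The index `k` names the region of the diagram between the strands `k - 1` and `k`, and
`α` codes a finite configuration of (possibly nested) circles placed in it: `0` is the empty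
configuration, the natural sum is juxtaposition, and `ω ^ α` is `α` enclosed in one more circle. -/
inductive LGen (n : ℕ) : Type 1
  | h (i : ℕ) (h1 : 1 ≤ i) (hn : i < n) : LGen n
  | c (k : ℕ) (h1 : 1 ≤ k) (hn : k ≤ n + 1) (α : Ordinal.{0}) (hα : α < ε₀) : LGen n

/-- The defining equations of `L_n`: the equations of `K_n` without circles, and the equations
that record in which regions of a diagram the circles are located. -/
inductive LRel (n : ℕ) : FreeMonoid (LGen n) → FreeMonoid (LGen n) → Prop
  | comm (i j : ℕ) (hi1 : 1 ≤ i) (hin : i < n) (hj1 : 1 ≤ j) (hjn : j < n) (hji : j + 1 < i) :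
      LRel n (of (.h i hi1 hin) * of (.h j hj1 hjn)) (of (.h j hj1 hjn) * of (.h i hi1 hin))
  | up (i : ℕ) (hi1 : 1 ≤ i) (hin : i < n) (hj1 : 1 ≤ i + 1) (hjn : i + 1 < n) :
      LRel n (of (.h i hi1 hin) * of (.h (i + 1) hj1 hjn) * of (.h i hi1 hin))
        (of (.h i hi1 hin))
  | down (i : ℕ) (hi1 : 1 ≤ i) (hin : i < n) (hj1 : 1 ≤ i + 1) (hjn : i + 1 < n) :
      LRel n (of (.h (i + 1) hj1 hjn) * of (.h i hi1 hin) * of (.h (i + 1) hj1 hjn))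
        (of (.h (i + 1) hj1 hjn))
  | circle_zero (k : ℕ) (hk1 : 1 ≤ k) (hkn : k ≤ n + 1) (h0 : (0 : Ordinal.{0}) < ε₀) :
      LRel n (of (.c k hk1 hkn 0 h0)) 1
  | circle_add (k : ℕ) (hk1 : 1 ≤ k) (hkn : k ≤ n + 1) (α β : Ordinal.{0})
      (hα : α < ε₀) (hβ : β < ε₀) (hαβ : natSum α β < ε₀) :
      LRel n (of (.c k hk1 hkn α hα) * of (.c k hk1 hkn β hβ))
        (of (.c k hk1 hkn (natSum α β) hαβ))
  | circle_circle (k l : ℕ) (hk1 : 1 ≤ k) (hkn : k ≤ n + 1) (hl1 : 1 ≤ l) (hln : l ≤ n + 1)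
      (hkl : k ≠ l) (α β : Ordinal.{0}) (hα : α < ε₀) (hβ : β < ε₀) :
      LRel n (of (.c k hk1 hkn α hα) * of (.c l hl1 hln β hβ))
        (of (.c l hl1 hln β hβ) * of (.c k hk1 hkn α hα))
  | circle_comm (i k : ℕ) (hi1 : 1 ≤ i) (hin : i < n) (hk1 : 1 ≤ k) (hkn : k ≤ n + 1)
      (hki : k ≠ i + 1) (α : Ordinal.{0}) (hα : α < ε₀) :
      LRel n (of (.h i hi1 hin) * of (.c k hk1 hkn α hα))
        (of (.c k hk1 hkn α hα) * of (.h i hi1 hin))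
  | circle_enclose (i : ℕ) (hi1 : 1 ≤ i) (hin : i < n) (hj1 : 1 ≤ i + 1) (hjn : i + 1 ≤ n + 1)
      (hin' : i ≤ n + 1) (α : Ordinal.{0}) (hα : α < ε₀) (hωα : ω ^ α < ε₀) :
      LRel n (of (.h i hi1 hin) * of (.c (i + 1) hj1 hjn α hα) * of (.h i hi1 hin))
        (of (.c i hi1 hin' (ω ^ α) hωα) * of (.h i hi1 hin))
  | circle_slide (i : ℕ) (hi1 : 1 ≤ i) (hin : i < n) (hj1 : 1 ≤ i + 2) (hjn : i + 2 ≤ n + 1)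
      (hin' : i ≤ n + 1) (α : Ordinal.{0}) (hα : α < ε₀) :
      LRel n (of (.c i hi1 hin' α hα) * of (.h i hi1 hin))
        (of (.c (i + 2) hj1 hjn α hα) * of (.h i hi1 hin))

/-- The monoid `L_n`. -/
abbrev L (n : ℕ) : Type 1 := PresentedMonoid (LRel n)

/-- The element `h^i` of `L_n`. -/
def L.h {n : ℕ} (i : ℕ) (h1 : 1 ≤ i) (hn : i < n) : L n := PresentedMonoid.of (LRel n) (.h i h1 hn)

end TemperleyLieb

/-! Existence of `f` and its injectivity are proved separately, each once for all three target
monoids.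

Existence: the relations in `SimplicialRelations` suffice to define a homomorphism out of `O n`. A
map `φ` is written as a word in the `p i` and `q i` with one run per point `k`: a run of `p`'s
bringing `k` down to `φ k`, or a run of `q`'s raising it. The lowering runs form `lowerProd`, the
raising runs `raiseProd`. With the lowering part on the left, the relations show that right
multiplication by `p i` turns the word of `φ` into the word of the product (`normalForm_mul_p`).
With the raising part on the left, the same holds for `q i` (`raiseProd_mul_lowerProd_mul_q`). The
two orders give the same element (`normalForm_eq`), so the word is multiplicative, because the `p i`
and `q i` generate `O n`. The products of `h`'s in the theorem satisfy these relations by the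
circle-free equations alone (`simplicialRelations`).

Injectivity: the diagram monoids act on sets of sequences. Odd `h`'s quantify a coordinate away,
even `h`'s impose equality of two neighbouring coordinates, and circles act trivially. Quantifying a
coordinate subject to an equality is substitution, so the image of `φ` acts as precomposition with
`φ`, and this determines `φ`. -/

namespace TemperleyLieb

/-! ### Simplicial relations and runs of consecutive generators. -/

section Blocks

variable {M : Type*} [Monoid M]

/-- The relations between the elements `p i` and `q i`, `i + 2 ≤ n`, that present `O n`. -/
structure SimplicialRelations (n : ℕ) (p q : ℕ → M) : Prop where
  p_idem (i : ℕ) (hi : i + 2 ≤ n) : p i * p i = p i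
  p_comm (i j : ℕ) (hi : i + 2 ≤ n) (hji : j + 1 < i) : Commute (p i) (p j)
  p_up (i : ℕ) (hi : i + 3 ≤ n) : p i * p (i + 1) * p i = p i * p (i + 1)
  p_down (i : ℕ) (hi : i + 3 ≤ n) : p (i + 1) * p i * p (i + 1) = p i * p (i + 1)
  q_idem (i : ℕ) (hi : i + 2 ≤ n) : q i * q i = q i
  q_comm (i j : ℕ) (hi : i + 2 ≤ n) (hji : j + 1 < i) : Commute (q i) (q j)
  q_up (i : ℕ) (hi : i + 3 ≤ n) : q i * q (i + 1) * q i = q (i + 1) * q i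
  q_down (i : ℕ) (hi : i + 3 ≤ n) : q (i + 1) * q i * q (i + 1) = q (i + 1) * q i
  p_mul_q (i : ℕ) (hi : i + 2 ≤ n) : p i * q i = p i
  q_mul_p (i : ℕ) (hi : i + 2 ≤ n) : q i * p i = q i
  p_mul_q_succ (i : ℕ) (hi : i + 3 ≤ n) : p i * q (i + 1) = q (i + 1)
  q_succ_mul_p (i : ℕ) (hi : i + 3 ≤ n) : q (i + 1) * p i = p i
  q_p_comm (i j : ℕ) (hi : i + 2 ≤ n) (hj : j + 2 ≤ n) (h1 : i ≠ j) (h2 : i ≠ j + 1) :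
    Commute (q i) (p j)

/-- The product `g a * g (a + 1) * ⋯ * g (b - 1)`, which is `1` if `b ≤ a`. -/
def ascProd (g : ℕ → M) (a : ℕ) : ℕ → M
  | 0 => 1
  | b + 1 => if a ≤ b then ascProd g a b * g b else 1

/-- The product `g (b - 1) * ⋯ * g (a + 1) * g a`, which is `1` if `b ≤ a`. -/
def descProd (g : ℕ → M) (a : ℕ) : ℕ → M
  | 0 => 1
  | b + 1 => if a ≤ b then g b * descProd g a b else 1

lemma ascProd_of_le (g : ℕ → M) {a b : ℕ} (h : b ≤ a) : ascProd g a b = 1 := by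
  cases b with
  | zero => rfl
  | succ b => rw [ascProd, if_neg (by omega)]

lemma descProd_of_le (g : ℕ → M) {a b : ℕ} (h : b ≤ a) : descProd g a b = 1 := by
  cases b with
  | zero => rfl
  | succ b => rw [descProd, if_neg (by omega)]

lemma ascProd_succ (g : ℕ → M) {a b : ℕ} (h : a ≤ b) :
    ascProd g a (b + 1) = ascProd g a b * g b := if_pos h

lemma descProd_succ (g : ℕ → M) {a b : ℕ} (h : a ≤ b) :
    descProd g a (b + 1) = g b * descProd g a b := if_pos h

lemma descProd_succ_left (g : ℕ → M) {a b : ℕ} (h : a < b) :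
    descProd g a b = descProd g (a + 1) b * g a := by
  induction b with
  | zero => omega
  | succ b ih =>
    rcases Nat.lt_or_ge a b with hab | hab
    · rw [descProd_succ g hab.le, descProd_succ g hab, ih hab, mul_assoc]
    · obtain rfl : a = b := by omega
      rw [descProd_succ g le_rfl, descProd_of_le g le_rfl, descProd_of_le g le_rfl, mul_one,
        one_mul]

lemma ascProd_induction (g : ℕ → M) {C : M → Prop} {a b : ℕ} (h1 : C 1)
    (hmul : ∀ x j, C x → a ≤ j → j < b → C (x * g j)) : C (ascProd g a b) := by
  induction b with
  | zero => exact h1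
  | succ b ih =>
    rcases Nat.lt_or_ge b a with hab | hab
    · rwa [ascProd_of_le g hab]
    · rw [ascProd_succ g hab]
      exact hmul _ _ (ih fun x j hx h h' => hmul x j hx h (by omega)) hab (by omega)

lemma descProd_induction (g : ℕ → M) {C : M → Prop} {a b : ℕ} (h1 : C 1)
    (hmul : ∀ x j, C x → a ≤ j → j < b → C (g j * x)) : C (descProd g a b) := by
  induction b with
  | zero => exact h1
  | succ b ih =>
    rcases Nat.lt_or_ge b a with hab | hab
    · rwa [descProd_of_le g hab]
    · rw [descProd_succ g hab]
      exact hmul _ _ (ih fun x j hx h h' => hmul x j hx h (by omega)) hab (by omega)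

lemma commute_ascProd (g : ℕ → M) {x : M} {a b : ℕ}
    (h : ∀ j, a ≤ j → j < b → Commute x (g j)) : Commute x (ascProd g a b) :=
  ascProd_induction g (C := Commute x) (Commute.one_right x) fun _ j hy h1 h2 =>
    hy.mul_right (h j h1 h2)

lemma commute_descProd (g : ℕ → M) {x : M} {a b : ℕ}
    (h : ∀ j, a ≤ j → j < b → Commute x (g j)) : Commute x (descProd g a b) :=
  descProd_induction g (C := Commute x) (Commute.one_right x) fun _ j hy h1 h2 =>
    (h j h1 h2).mul_right hy

end Blocks

/-! ### Absorption and exchange rules for runs. -/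

namespace SimplicialRelations

variable {M : Type*} [Monoid M] {n : ℕ} {p q : ℕ → M} (R : SimplicialRelations n p q)
include R

lemma q_comm' {i j : ℕ} (hi : i + 2 ≤ n) (hj : j + 2 ≤ n) (h1 : j + 1 ≠ i) (h2 : i + 1 ≠ j) :
    Commute (q i) (q j) := by
  rcases lt_trichotomy i j with h | rfl | h
  · exact (R.q_comm j i hj (by omega)).symm
  · exact Commute.refl _
  · exact R.q_comm i j hi (by omega)

/-- In `O n` the run collapses the interval from `a` to `b` onto `a`, so a generator acting inside
that interval changes nothing. Abstractly, `p j` commutes to the left until it meets `p (j + 1)`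
preceded by `p j`, where `p_up` removes it. -/
lemma ascProd_mul_p {a b j : ℕ} (haj : a ≤ j) (hjb : j < b) (hb : b + 1 ≤ n) :
    ascProd p a b * p j = ascProd p a b := by
  induction b with
  | zero => omega
  | succ b ih =>
    rw [ascProd_succ p (by omega)]
    rcases Nat.lt_or_ge j b with h | h
    · rcases Nat.lt_or_ge (j + 1) b with h' | h'
      · rw [mul_assoc, (R.p_comm b j (by omega) h').eq, ← mul_assoc, ih h (by omega)]
      · obtain rfl : b = j + 1 := by omega
        rw [ascProd_succ p haj]
        simp only [mul_assoc]
        rw [← mul_assoc (p j), R.p_up j (by omega)]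
    · obtain rfl : j = b := by omega
      rw [mul_assoc, R.p_idem j (by omega)]

lemma p_mul_ascProd {a b j : ℕ} (haj : a ≤ j) (hjb : j < b) (hb : b + 1 ≤ n) :
    p j * ascProd p a b = ascProd p a b := by
  induction b with
  | zero => omega
  | succ b ih =>
    rw [ascProd_succ p (by omega)]
    rcases Nat.lt_or_ge j b with h | h
    · rw [← mul_assoc, ih h (by omega)]
    · obtain rfl : j = b := by omega
      cases j with
      | zero => rw [ascProd_of_le p (Nat.zero_le a), one_mul, R.p_idem 0 (by omega)]
      | succ j =>
        rcases Nat.lt_or_ge j a with h' | h'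
        · rw [ascProd_of_le p (by omega), one_mul, R.p_idem _ (by omega)]
        · rw [ascProd_succ p h', ← mul_assoc, ← mul_assoc,
            (commute_ascProd p fun k _ h2 => R.p_comm (j + 1) k (by omega) (by omega)).eq]
          simp only [mul_assoc]
          rw [← mul_assoc (p (j + 1)), R.p_down j (by omega)]

lemma descProd_mul_q {a b j : ℕ} (haj : a ≤ j) (hjb : j < b) (hb : b + 1 ≤ n) :
    descProd q a b * q j = descProd q a b := by
  induction b with
  | zero => omega
  | succ b ih =>
    rw [descProd_succ q (by omega)]
    rcases Nat.lt_or_ge j b with h | h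
    · rw [mul_assoc, ih h (by omega)]
    · obtain rfl : j = b := by omega
      cases j with
      | zero => rw [descProd_of_le q (Nat.zero_le a), mul_one, R.q_idem 0 (by omega)]
      | succ j =>
        rcases Nat.lt_or_ge j a with h' | h'
        · rw [descProd_of_le q (by omega), mul_one, R.q_idem _ (by omega)]
        · rw [descProd_succ q h', mul_assoc, mul_assoc,
            ← (commute_descProd q fun k _ h2 => R.q_comm (j + 1) k (by omega) (by omega)).eq,
            ← mul_assoc (q j), ← mul_assoc (q (j + 1)), ← mul_assoc (q (j + 1)),
            R.q_down j (by omega), mul_assoc]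

lemma q_mul_descProd {a b j : ℕ} (haj : a ≤ j) (hjb : j < b) (hb : b + 1 ≤ n) :
    q j * descProd q a b = descProd q a b := by
  induction b with
  | zero => omega
  | succ b ih =>
    rw [descProd_succ q (by omega)]
    rcases Nat.lt_or_ge j b with h | h
    · rcases Nat.lt_or_ge (j + 1) b with h' | h'
      · rw [← mul_assoc, ← (R.q_comm b j (by omega) h').eq, mul_assoc, ih h (by omega)]
      · obtain rfl : b = j + 1 := by omega
        rw [descProd_succ q haj, ← mul_assoc, ← mul_assoc, R.q_up j (by omega), mul_assoc]
    · obtain rfl : j = b := by omega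
      rw [← mul_assoc, R.q_idem j (by omega)]

lemma ascProd_mul_ascProd {a a' b b' : ℕ} (ha : a ≤ a') (hb' : b' ≤ b) (hb : b + 1 ≤ n) :
    ascProd p a b * ascProd p a' b' = ascProd p a b :=
  ascProd_induction p (C := fun x => ascProd p a b * x = ascProd p a b) (mul_one _)
    fun x j hx h1 h2 => by rw [← mul_assoc, hx, R.ascProd_mul_p (by omega) (by omega) hb]

lemma ascProd_mul_ascProd' {a a' b b' : ℕ} (ha : a ≤ a') (hb' : b' ≤ b) (hb : b + 1 ≤ n) :
    ascProd p a' b' * ascProd p a b = ascProd p a b :=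
  ascProd_induction p (C := fun x => x * ascProd p a b = ascProd p a b) (one_mul _)
    fun x j hx h1 h2 => by rw [mul_assoc, R.p_mul_ascProd (by omega) (by omega) hb, hx]

lemma descProd_mul_descProd {a a' b b' : ℕ} (ha : a ≤ a') (hb' : b' ≤ b) (hb : b + 1 ≤ n) :
    descProd q a b * descProd q a' b' = descProd q a b :=
  descProd_induction q (C := fun x => descProd q a b * x = descProd q a b) (mul_one _)
    fun x j hx h1 h2 => by rw [← mul_assoc, R.descProd_mul_q (by omega) (by omega) hb, hx]

lemma descProd_mul_descProd' {a a' b b' : ℕ} (ha : a ≤ a') (hb' : b' ≤ b) (hb : b + 1 ≤ n) :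
    descProd q a' b' * descProd q a b = descProd q a b :=
  descProd_induction q (C := fun x => x * descProd q a b = descProd q a b) (one_mul _)
    fun x j hx h1 h2 => by rw [mul_assoc, hx, R.q_mul_descProd (by omega) (by omega) hb]

/-- The last factor `q (i + 1)` is swallowed by `p i`, and the remaining factors have indices far
enough from `i` to commute with it. The lower end of the run therefore moves up by one. -/
lemma descProd_succ_mul_p {i b : ℕ} (hi : i + 2 ≤ n) (hb : b + 1 ≤ n) :
    descProd q (i + 1) b * p i = p i * descProd q (i + 2) b := by
  rcases Nat.lt_or_ge (i + 1) b with h | h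
  · rw [descProd_succ_left q h, mul_assoc, R.q_succ_mul_p i (by omega)]
    exact (commute_descProd q fun j h1 h2 =>
      (R.q_p_comm j i (by omega) (by omega) (by omega) (by omega)).symm).eq.symm
  · rw [descProd_of_le q h, descProd_of_le q (by omega), one_mul, mul_one]

lemma descProd_mul_p {i b : ℕ} (hib : i < b) (hb : b + 1 ≤ n) :
    descProd q i b * p i = descProd q i b := by
  rw [descProd_succ_left q hib, mul_assoc, R.q_mul_p i (by omega)]

/-- The mirror rule: the last factor `p i` is swallowed by `q (i + 1)`, which commutes with the
rest. -/
lemma ascProd_mul_q {a i : ℕ} (hi : i + 3 ≤ n) :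
    ascProd p a (i + 1) * q (i + 1) = q (i + 1) * ascProd p a i := by
  rcases Nat.lt_or_ge i a with h | h
  · rw [ascProd_of_le p (by omega), ascProd_of_le p (by omega), one_mul, mul_one]
  · rw [ascProd_succ p h, mul_assoc, R.p_mul_q_succ i hi]
    exact (commute_ascProd p fun j h1 h2 =>
      R.q_p_comm (i + 1) j (by omega) (by omega) (by omega) (by omega)).eq.symm

lemma ascProd_succ_mul_q {a i : ℕ} (hai : a ≤ i) (hi : i + 2 ≤ n) :
    ascProd p a (i + 1) * q i = ascProd p a (i + 1) := by
  rw [ascProd_succ p hai, mul_assoc, R.p_mul_q i hi]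

end SimplicialRelations

/-! ### Multiplying lowering and raising words by a generator. -/

section NormalForm

variable {M : Type*} [Monoid M]

/-- The normal form of the lowering part of `φ`, built from its values below `k`. -/
def lowerProd (p : ℕ → M) (φ : ℕ → ℕ) : ℕ → M
  | 0 => 1
  | k + 1 => ascProd p (φ k) k * lowerProd p φ k

/-- The normal form of the raising part of `φ`, built from its values below `k`. -/
def raiseProd (q : ℕ → M) (φ : ℕ → ℕ) : ℕ → M
  | 0 => 1
  | k + 1 => raiseProd q φ k * descProd q k (φ k)

/-- The action of `p^i` on all natural numbers. -/
def pMap (i j : ℕ) : ℕ := if j = i + 1 then i else j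

/-- The action of `q^i` on all natural numbers. -/
def qMap (i j : ℕ) : ℕ := if j = i then i + 1 else j

lemma lowerProd_congr (p : ℕ → M) {φ ψ : ℕ → ℕ} {k : ℕ}
    (h : ∀ j < k, ascProd p (φ j) j = ascProd p (ψ j) j) :
    lowerProd p φ k = lowerProd p ψ k := by
  induction k with
  | zero => rfl
  | succ k ih => rw [lowerProd, lowerProd, ih fun j hj => h j (by omega), h k (by omega)]

lemma raiseProd_congr (q : ℕ → M) {φ ψ : ℕ → ℕ} {k : ℕ}
    (h : ∀ j < k, descProd q j (φ j) = descProd q j (ψ j)) :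
    raiseProd q φ k = raiseProd q ψ k := by
  induction k with
  | zero => rfl
  | succ k ih => rw [raiseProd, raiseProd, ih fun j hj => h j (by omega), h k (by omega)]

lemma lowerProd_of_le (p : ℕ → M) {φ : ℕ → ℕ} {k : ℕ} (h : ∀ j < k, j ≤ φ j) :
    lowerProd p φ k = 1 := by
  induction k with
  | zero => rfl
  | succ k ih =>
    rw [lowerProd, ih fun j hj => h j (by omega), ascProd_of_le p (h k (by omega)), one_mul]

lemma raiseProd_of_le (q : ℕ → M) {φ : ℕ → ℕ} {k : ℕ} (h : ∀ j < k, φ j ≤ j) :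
    raiseProd q φ k = 1 := by
  induction k with
  | zero => rfl
  | succ k ih =>
    rw [raiseProd, ih fun j hj => h j (by omega), descProd_of_le q (h k (by omega)), one_mul]

lemma commute_lowerProd (p : ℕ → M) {φ : ℕ → ℕ} {x : M} {k : ℕ}
    (h : ∀ l < k, ∀ j, φ l ≤ j → j < l → Commute x (p j)) : Commute x (lowerProd p φ k) := by
  induction k with
  | zero => exact Commute.one_right x
  | succ k ih =>
    exact (commute_ascProd p fun j => h k (by omega) j).mul_right
      (ih fun l hl => h l (by omega))

lemma commute_raiseProd (q : ℕ → M) {φ : ℕ → ℕ} {x : M} {k : ℕ}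
    (h : ∀ l < k, ∀ j, l ≤ j → j < φ l → Commute x (q j)) : Commute x (raiseProd q φ k) := by
  induction k with
  | zero => exact Commute.one_right x
  | succ k ih =>
    exact (ih fun l hl => h l (by omega)).mul_right
      (commute_descProd q fun j => h k (by omega) j)

namespace SimplicialRelations

variable {n : ℕ} {p q : ℕ → M} (R : SimplicialRelations n p q)
  {φ : ℕ → ℕ} (hφ : Monotone φ) (hn : ∀ k < n, φ k < n) (hn' : ∀ k, n ≤ k → φ k = k) {i : ℕ}
  (hi : i + 2 ≤ n)
include R hφ hi

-- The letter `p i` slides to the run of the point `i` and lengthens it by one. The longer run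
-- absorbs the run of `i + 1`, as it should, since `i + 1` now goes to `φ i`.
omit hi in
lemma lowerProd_mul_p (h : φ i ≤ i) {k : ℕ} (hk : i + 2 ≤ k) (hkn : k ≤ n) :
    lowerProd p φ k * p i = lowerProd p (φ ∘ pMap i) k := by
  induction k, hk using Nat.le_induction with
  | base =>
    have e : lowerProd p (φ ∘ pMap i) i = lowerProd p φ i :=
      lowerProd_congr p fun j hj => by simp [pMap, show j ≠ i + 1 by omega]
    have c : Commute (p i) (lowerProd p φ i) := commute_lowerProd p fun l hl j h1 h2 =>
      R.p_comm i j (by omega) (by omega)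
    have := hφ (Nat.le_succ i)
    simp only [lowerProd, e]
    simp only [Function.comp, pMap, if_true, show i ≠ i + 1 by omega, if_false]
    simp only [mul_assoc]
    rw [← c.eq, ← mul_assoc (ascProd p (φ i) i), ← ascProd_succ p h, ← mul_assoc, ← mul_assoc,
      R.ascProd_mul_ascProd' this le_rfl (by omega),
      R.ascProd_mul_ascProd le_rfl (by omega) (by omega)]
  | succ k hk ih =>
    rw [lowerProd, lowerProd, mul_assoc, ih (by omega)]
    simp [pMap, show k ≠ i + 1 by omega]

omit R hi in
lemma lowerProd_comp_pMap (h : i + 1 ≤ φ i) (k : ℕ) :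
    lowerProd p (φ ∘ pMap i) k = lowerProd p φ k := by
  refine lowerProd_congr p fun j _ => ?_
  by_cases hj : j = i + 1
  · subst hj
    have := hφ (Nat.le_succ i)
    rw [ascProd_of_le p (by simpa [pMap] using h), ascProd_of_le p (by simpa using h.trans this)]
  · simp [pMap, hj]

/-- Here `i + 1` is not lowered, so its run is trivial and `q i` passes through the whole word. On
its way it shortens the run of `i`, and the shortened run is absorbed by the run of `i - 1`. -/
lemma lowerProd_mul_q_of_lt (h : i + 1 ≤ φ (i + 1)) {k : ℕ} (hk : i + 2 ≤ k) (hkn : k ≤ n) :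
    lowerProd p φ k * q i = q i * lowerProd p (φ ∘ qMap i) k := by
  induction k, hk using Nat.le_induction with
  | base =>
    have e : lowerProd p (φ ∘ qMap i) i = lowerProd p φ i :=
      lowerProd_congr p fun j hj => by simp [qMap, show j ≠ i by omega]
    simp only [lowerProd, e]
    simp only [Function.comp, qMap, if_true, show i + 1 ≠ i by omega, if_false]
    rw [ascProd_of_le p h, ascProd_of_le p (by omega : i ≤ φ (i + 1)), one_mul, one_mul, one_mul]
    -- The absorbing run belongs to the predecessor of `i`; for `i = 0` the runs involved are empty.
    cases i with
    | zero => simp [ascProd, lowerProd]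
    | succ s =>
      have c : Commute (q (s + 1)) (lowerProd p φ (s + 1)) :=
        commute_lowerProd p fun l hl j h1 h2 =>
          R.q_p_comm (s + 1) j (by omega) (by omega) (by omega) (by omega)
      rw [mul_assoc, ← c.eq, ← mul_assoc, R.ascProd_mul_q (by omega), mul_assoc, lowerProd,
        ← mul_assoc (ascProd p _ s),
        R.ascProd_mul_ascProd' (hφ (Nat.le_succ s)) le_rfl (by omega)]
  | succ k hk ih =>
    have h' : φ (i + 1) ≤ φ k := hφ (by omega)
    have c : Commute (q i) (ascProd p (φ k) k) := commute_ascProd p fun j h1 h2 =>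
      R.q_p_comm i j (by omega) (by omega) (by omega) (by omega)
    rw [lowerProd, lowerProd, mul_assoc, ih (by omega), ← mul_assoc, ← c.eq, mul_assoc]
    simp [qMap, show k ≠ i by omega]

lemma lowerProd_mul_q_of_le (h : φ (i + 1) ≤ i) {k : ℕ} (hk : i + 2 ≤ k) (hkn : k ≤ n) :
    lowerProd p φ k * q i = lowerProd p (φ ∘ qMap i) k := by
  induction k, hk using Nat.le_induction with
  | base =>
    have e : lowerProd p (φ ∘ qMap i) i = lowerProd p φ i :=
      lowerProd_congr p fun j hj => by simp [qMap, show j ≠ i by omega]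
    simp only [lowerProd, e]
    simp only [Function.comp, qMap, if_true, show i + 1 ≠ i by omega, if_false]
    rw [← mul_assoc _ (ascProd p (φ (i + 1)) i),
      R.ascProd_mul_ascProd le_rfl (by omega) (by omega)]
    cases i with
    | zero =>
      simp only [ascProd_of_le p (Nat.zero_le (φ 0)), lowerProd, mul_one]
      exact R.ascProd_succ_mul_q h hi
    | succ s =>
      have c : Commute (q (s + 1)) (lowerProd p φ (s + 1)) :=
        commute_lowerProd p fun l hl j h1 h2 =>
          R.q_p_comm (s + 1) j (by omega) (by omega) (by omega) (by omega)
      rw [mul_assoc, mul_assoc, ← c.eq, ← mul_assoc (ascProd p (φ (s + 1)) (s + 1)),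
        R.ascProd_mul_q (by omega), mul_assoc, lowerProd, ← mul_assoc (ascProd p _ s),
        R.ascProd_mul_ascProd' (hφ (Nat.le_succ s)) le_rfl (by omega), ← mul_assoc,
        R.ascProd_succ_mul_q h hi]
  | succ k hk ih =>
    rw [lowerProd, lowerProd, mul_assoc, ih (by omega)]
    simp [qMap, show k ≠ i by omega]

include hn in
lemma raiseProd_mul_q (h : i + 1 ≤ φ (i + 1)) {k : ℕ} (hk : i + 2 ≤ k) (hkn : k ≤ n) :
    raiseProd q φ k * q i = raiseProd q (φ ∘ qMap i) k := by
  induction k, hk using Nat.le_induction with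
  | base =>
    have e : raiseProd q (φ ∘ qMap i) i = raiseProd q φ i :=
      raiseProd_congr q fun j hj => by simp [qMap, show j ≠ i by omega]
    have h1 : φ i ≤ φ (i + 1) := hφ (Nat.le_succ i)
    have h2 := hn (i + 1) (by omega)
    simp only [raiseProd, e]
    simp only [Function.comp, qMap, if_true, show i + 1 ≠ i by omega, if_false]
    simp only [mul_assoc]
    rw [← descProd_succ_left q h, R.descProd_mul_descProd' le_rfl h1 (by omega),
      R.descProd_mul_descProd (by omega) le_rfl (by omega)]
  | succ k hk ih =>
    have h2 := hn k (by omega)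
    have c : Commute (q i) (descProd q k (φ k)) := commute_descProd q fun j h1 h2 =>
      R.q_comm' (by omega) (by omega) (by omega) (by omega)
    rw [raiseProd, raiseProd, mul_assoc, ← c.eq, ← mul_assoc, ih (by omega)]
    simp [qMap, show k ≠ i by omega]

omit R hi in
lemma raiseProd_comp_qMap (h : φ (i + 1) ≤ i) (k : ℕ) :
    raiseProd q (φ ∘ qMap i) k = raiseProd q φ k := by
  refine raiseProd_congr q fun j _ => ?_
  by_cases hj : j = i
  · subst hj
    have := hφ (Nat.le_succ j)
    rw [descProd_of_le q (by simpa [qMap] using h), descProd_of_le q (by simpa using this.trans h)]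
  · simp [qMap, hj]

include hn hn'

/-- The run of `i` is trivial, and `p i` passes to the left, shortening the run of `i + 1`. The
shortened run starts at `i + 2` and is absorbed by the run of `i + 2`. That run must be present,
hence `i + 3 ≤ k`, and for `i + 2 = n` it is the empty run of the fixed point `n`. -/
lemma raiseProd_mul_p_of_le (h : φ i ≤ i) {k : ℕ} (hk : i + 3 ≤ k) (hkn : k ≤ n + 1) :
    raiseProd q φ k * p i = p i * raiseProd q (φ ∘ pMap i) k := by
  have cb (k) (hk : i + 2 ≤ k) (hkn : k ≤ n) : Commute (p i) (descProd q k (φ k)) :=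
    commute_descProd q fun j h1 h2 =>
      (R.q_p_comm j i (by have := hn k; have := hn' k; omega) (by omega) (by omega) (by omega)).symm
  induction k, hk using Nat.le_induction with
  | base =>
    have e : raiseProd q (φ ∘ pMap i) i = raiseProd q φ i :=
      raiseProd_congr q fun j hj => by simp [pMap, show j ≠ i + 1 by omega]
    have c : Commute (p i) (raiseProd q φ i) := commute_raiseProd q fun l hl j h1 h2 => by
      have : φ l ≤ φ i := hφ hl.le
      exact (R.q_p_comm j i (by omega) (by omega) (by omega) (by omega)).symm
    have h1 : φ (i + 1) ≤ φ (i + 2) := hφ (by omega)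
    have h2 := hn (i + 1) (by omega)
    -- If `i + 2 = n`, then `φ (i + 1) < n` makes the left run empty.
    have a : descProd q (i + 2) (φ (i + 1)) * descProd q (i + 2) (φ (i + 2)) =
        descProd q (i + 2) (φ (i + 2)) := by
      rcases Nat.lt_or_ge (i + 2) n with h' | h'
      · exact R.descProd_mul_descProd' le_rfl h1 (hn _ h')
      · rw [descProd_of_le q (by omega : φ (i + 1) ≤ i + 2), one_mul]
    simp only [raiseProd, e]
    simp only [Function.comp, pMap, if_true, show i ≠ i + 1 by omega,
      show i + 2 ≠ i + 1 by omega, if_false]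
    rw [descProd_of_le q h, descProd_of_le q (by omega : φ i ≤ i + 1), mul_one, mul_one,
      mul_assoc, ← (cb _ le_rfl hi).eq, mul_assoc, ← mul_assoc (descProd q (i + 1) _),
      R.descProd_succ_mul_p hi h2, mul_assoc, a, ← mul_assoc, ← c.eq, mul_assoc]
  | succ k hk ih =>
    rw [raiseProd, raiseProd, mul_assoc, ← (cb k (by omega) (by omega)).eq, ← mul_assoc,
      ih (by omega), mul_assoc]
    simp [pMap, show k ≠ i + 1 by omega]

/-- Now `i` is genuinely raised, so its run ends in `q i` and swallows `p i` by `q_mul_p`. Nothing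
comes out on the left. -/
lemma raiseProd_mul_p_of_lt (h : i + 1 ≤ φ i) {k : ℕ} (hk : i + 3 ≤ k) (hkn : k ≤ n + 1) :
    raiseProd q φ k * p i = raiseProd q (φ ∘ pMap i) k := by
  have cb (k) (hk : i + 2 ≤ k) (hkn : k ≤ n) : Commute (p i) (descProd q k (φ k)) :=
    commute_descProd q fun j h1 h2 =>
      (R.q_p_comm j i (by have := hn k; have := hn' k; omega) (by omega) (by omega) (by omega)).symm
  induction k, hk using Nat.le_induction with
  | base =>
    have e : raiseProd q (φ ∘ pMap i) i = raiseProd q φ i :=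
      raiseProd_congr q fun j hj => by simp [pMap, show j ≠ i + 1 by omega]
    have h1 : φ (i + 1) ≤ φ (i + 2) := hφ (by omega)
    have h2 := hn (i + 1) (by omega)
    have h3 := hn i (by omega)
    have a : descProd q (i + 2) (φ (i + 1)) * descProd q (i + 2) (φ (i + 2)) =
        descProd q (i + 2) (φ (i + 2)) := by
      rcases Nat.lt_or_ge (i + 2) n with h' | h'
      · exact R.descProd_mul_descProd' le_rfl h1 (hn _ h')
      · rw [descProd_of_le q (by omega : φ (i + 1) ≤ i + 2), one_mul]
    simp only [raiseProd, e]
    simp only [Function.comp, pMap, if_true, show i ≠ i + 1 by omega,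
      show i + 2 ≠ i + 1 by omega, if_false]
    rw [mul_assoc _ _ (p i), ← (cb _ le_rfl hi).eq, mul_assoc, ← mul_assoc (descProd q (i + 1) _),
      R.descProd_succ_mul_p hi h2, mul_assoc (p i), a, mul_assoc, ← mul_assoc (descProd q i _),
      R.descProd_mul_p h h3, mul_assoc (raiseProd q φ i) _ (descProd q (i + 1) _),
      R.descProd_mul_descProd (by omega) le_rfl h3, mul_assoc]
  | succ k hk ih =>
    rw [raiseProd, raiseProd, mul_assoc, ← (cb k (by omega) (by omega)).eq, ← mul_assoc,
      ih (by omega)]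
    simp [pMap, show k ≠ i + 1 by omega]

end SimplicialRelations
end NormalForm

/-! ### Order-preserving maps as functions on `ℕ`, and their factorization. -/

section Extension

variable {n : ℕ}

/-- The extension of an order-preserving map of `Fin n` to `ℕ` that fixes every `k ≥ n`. -/
def O.ext (φ : O n) (k : ℕ) : ℕ := if h : k < n then φ ⟨k, h⟩ else k

lemma O.ext_of_lt (φ : O n) {k : ℕ} (h : k < n) : φ.ext k = φ ⟨k, h⟩ := dif_pos h

lemma O.ext_of_le (φ : O n) {k : ℕ} (h : n ≤ k) : φ.ext k = k := dif_neg h.not_gt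

lemma O.ext_lt (φ : O n) {k : ℕ} (h : k < n) : φ.ext k < n := by
  rw [φ.ext_of_lt h]
  exact (φ _).2

lemma O.ext_monotone (φ : O n) : Monotone φ.ext := by
  intro a b hab
  rcases Nat.lt_or_ge b n with hb | hb
  · rw [φ.ext_of_lt hb, φ.ext_of_lt (hab.trans_lt hb)]
    exact φ.monotone hab
  · rw [φ.ext_of_le hb]
    rcases Nat.lt_or_ge a n with ha | ha
    · exact (φ.ext_lt ha).le.trans hb
    · rwa [φ.ext_of_le ha]

lemma O.ext_one : (1 : O n).ext = id := by
  funext k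
  by_cases h : k < n
  · rw [O.ext_of_lt _ h]; rfl
  · exact O.ext_of_le _ (not_lt.1 h)

lemma O.ext_mul (φ ψ : O n) : (φ * ψ).ext = φ.ext ∘ ψ.ext := by
  funext k
  by_cases h : k < n
  · rw [O.ext_of_lt _ h, Function.comp, O.ext_of_lt ψ h, O.ext_of_lt φ (ψ _).2]; rfl
  · rw [O.ext_of_le _ (not_lt.1 h), Function.comp, O.ext_of_le ψ (not_lt.1 h),
      O.ext_of_le φ (not_lt.1 h)]

lemma O.ext_injective : Function.Injective (O.ext : O n → ℕ → ℕ) := by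
  intro φ ψ h
  refine OrderHom.ext _ _ (funext fun j => Fin.ext ?_)
  have := congrFun h j
  rwa [O.ext_of_lt φ j.2, O.ext_of_lt ψ j.2] at this

lemma O.ext_p (i : ℕ) (hi : i + 2 ≤ n) : (O.p i hi).ext = pMap i := by
  funext k
  by_cases h : k < n
  · rw [O.ext_of_lt _ h, pMap]
    change ((if k = i + 1 then ⟨i, _⟩ else ⟨k, h⟩ : Fin n) : ℕ) = _
    split_ifs <;> rfl
  · rw [O.ext_of_le _ (not_lt.1 h), pMap, if_neg (by omega)]

lemma O.ext_q (i : ℕ) (hi : i + 2 ≤ n) : (O.q i hi).ext = qMap i := by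
  funext k
  by_cases h : k < n
  · rw [O.ext_of_lt _ h, qMap]
    change ((if k = i then ⟨i + 1, _⟩ else ⟨k, h⟩ : Fin n) : ℕ) = _
    split_ifs <;> rfl
  · rw [O.ext_of_le _ (not_lt.1 h), qMap, if_neg (by omega)]

/-! ### Generation of `O n` -/

/-- The map `p^i`, with the value `1` for the indices that are out of range. -/
def O.pGen (n i : ℕ) : O n := if hi : i + 2 ≤ n then O.p i hi else 1

/-- The map `q^i`, with the value `1` for the indices that are out of range. -/
def O.qGen (n i : ℕ) : O n := if hi : i + 2 ≤ n then O.q i hi else 1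

/-- The maps `p^i`. -/
def O.pSet (n : ℕ) : Set (O n) := {φ | ∃ (i : ℕ) (hi : i + 2 ≤ n), φ = O.p i hi}

/-- The maps `q^i`. -/
def O.qSet (n : ℕ) : Set (O n) := {φ | ∃ (i : ℕ) (hi : i + 2 ≤ n), φ = O.q i hi}

lemma O.pGen_mem (i : ℕ) : O.pGen n i ∈ Submonoid.closure (O.pSet n) := by
  rw [O.pGen]
  split_ifs with hi
  · exact Submonoid.subset_closure ⟨i, hi, rfl⟩
  · exact one_mem _

lemma O.qGen_mem (i : ℕ) : O.qGen n i ∈ Submonoid.closure (O.qSet n) := by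
  rw [O.qGen]
  split_ifs with hi
  · exact Submonoid.subset_closure ⟨i, hi, rfl⟩
  · exact one_mem _

lemma ascProd_mem {M : Type*} [Monoid M] {S : Submonoid M} {g : ℕ → M} (h : ∀ i, g i ∈ S)
    (a b : ℕ) : ascProd g a b ∈ S :=
  ascProd_induction g (C := (· ∈ S)) (one_mem S) fun _ j hx _ _ => mul_mem hx (h j)

lemma descProd_mem {M : Type*} [Monoid M] {S : Submonoid M} {g : ℕ → M} (h : ∀ i, g i ∈ S)
    (a b : ℕ) : descProd g a b ∈ S :=
  descProd_induction g (C := (· ∈ S)) (one_mem S) fun _ j hx _ _ => mul_mem (h j) hx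

lemma lowerProd_mem {M : Type*} [Monoid M] {S : Submonoid M} {g : ℕ → M} (h : ∀ i, g i ∈ S)
    (φ : ℕ → ℕ) (k : ℕ) : lowerProd g φ k ∈ S := by
  induction k with
  | zero => exact one_mem S
  | succ k ih => exact mul_mem (ascProd_mem h _ _) ih

lemma raiseProd_mem {M : Type*} [Monoid M] {S : Submonoid M} {g : ℕ → M} (h : ∀ i, g i ∈ S)
    (φ : ℕ → ℕ) (k : ℕ) : raiseProd g φ k ∈ S := by
  induction k with
  | zero => exact one_mem S
  | succ k ih => exact mul_mem ih (descProd_mem h _ _)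

lemma O.ext_ascProd {a b : ℕ} (hb : b < n) (j : ℕ) :
    (ascProd (O.pGen n) a b).ext j = if a ≤ j ∧ j ≤ b then a else j := by
  induction b generalizing j with
  | zero => simp only [ascProd, O.ext_one, id]; split_ifs <;> omega
  | succ b ih =>
    rcases Nat.lt_or_ge b a with hab | hab
    · rw [ascProd_of_le _ hab, O.ext_one, id]; split_ifs <;> omega
    · rw [ascProd_succ _ hab, O.ext_mul, Function.comp, ih (by omega), O.pGen,
        dif_pos (show b + 2 ≤ n from hb), O.ext_p, pMap]
      split_ifs <;> omega

lemma O.ext_descProd {a b : ℕ} (hb : b < n) (j : ℕ) :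
    (descProd (O.qGen n) a b).ext j = if a ≤ j ∧ j ≤ b then b else j := by
  induction b generalizing j with
  | zero => simp only [descProd, O.ext_one, id]; split_ifs <;> omega
  | succ b ih =>
    rcases Nat.lt_or_ge b a with hab | hab
    · rw [descProd_of_le _ hab, O.ext_one, id]; split_ifs <;> omega
    · rw [descProd_succ _ hab, O.ext_mul, Function.comp, ih (by omega), O.qGen,
        dif_pos (show b + 2 ≤ n from hb), O.ext_q, qMap]
      split_ifs <;> omega

lemma O.ext_lowerProd {φ : ℕ → ℕ} (hφ : Monotone φ) {k : ℕ} (hk : k ≤ n) (j : ℕ) :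
    (lowerProd (O.pGen n) φ k).ext j = if j < k then min (φ j) j else j := by
  induction k with
  | zero => simp [lowerProd, O.ext_one]
  | succ k ih =>
    rw [lowerProd, O.ext_mul, Function.comp, ih (by omega), O.ext_ascProd (by omega)]
    have : j < k → φ j ≤ φ k := fun h => hφ h.le
    rcases lt_trichotomy j k with h | rfl | h
    · have := this h
      simp only [h, if_true, show j < k + 1 by omega]
      split_ifs <;> omega
    · simp only [lt_irrefl, if_false, show j < j + 1 by omega, if_true]
      split_ifs <;> omega
    · simp only [show ¬ j < k by omega, if_false, show ¬ j < k + 1 by omega]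
      split_ifs <;> omega

/-- The second clause serves the induction: the run of `k` acts first, and the point it produces
must be left alone by the runs of smaller points. Monotonicity puts that point at or above all their
values. -/
lemma O.ext_raiseProd {φ : ℕ → ℕ} (hφ : Monotone φ) (hn : ∀ k < n, φ k < n) {k : ℕ}
    (hk : k ≤ n) (j : ℕ) :
    (j < k → (raiseProd (O.qGen n) φ k).ext j = max (φ j) j) ∧
      (k ≤ j → (∀ l < k, φ l ≤ j) → (raiseProd (O.qGen n) φ k).ext j = j) := by
  induction k generalizing j with
  | zero => simp [raiseProd, O.ext_one]
  | succ k ih =>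
    rw [raiseProd, O.ext_mul, Function.comp, O.ext_descProd (hn k (by omega))]
    refine ⟨fun h => ?_, fun h h' => ?_⟩
    · rcases Nat.lt_succ_iff_lt_or_eq.1 h with h | rfl
      · rw [if_neg (by omega)]
        exact (ih (by omega) j).1 h
      · have e : (if j ≤ j ∧ j ≤ φ j then φ j else j) = max (φ j) j := by
          split_ifs <;> omega
        rw [e]
        exact (ih (by omega) _).2 (le_max_right _ _) fun l hl => (hφ hl.le).trans (le_max_left _ _)
    · have := h' k (by omega)
      have e : (if k ≤ j ∧ j ≤ φ k then φ k else j) = j := by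
        split_ifs <;> omega
      rw [e]
      exact (ih (by omega) j).2 (by omega) fun l hl => h' l (by omega)

lemma O.exists_eq_mul (φ : O n) : ∃ u ∈ Submonoid.closure (O.qSet n),
    ∃ d ∈ Submonoid.closure (O.pSet n), φ = u * d ∧
      (∀ j < n, u.ext j = max (φ.ext j) j) ∧ ∀ j < n, d.ext j = min (φ.ext j) j := by
  have hu : ∀ j < n, (raiseProd (O.qGen n) φ.ext n).ext j = max (φ.ext j) j := fun j hj =>
    (O.ext_raiseProd φ.ext_monotone (fun _ => φ.ext_lt) le_rfl j).1 hj
  have hd : ∀ j < n, (lowerProd (O.pGen n) φ.ext n).ext j = min (φ.ext j) j := fun j hj => by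
    rw [O.ext_lowerProd φ.ext_monotone le_rfl, if_pos hj]
  refine ⟨_, raiseProd_mem O.qGen_mem φ.ext n, _, lowerProd_mem O.pGen_mem φ.ext n,
    O.ext_injective (funext fun j => ?_), hu, hd⟩
  -- If `φ j ≤ j`, monotonicity gives `φ (φ j) ≤ φ j`, so the raising part fixes the already lowered
  -- point. Otherwise the lowering part fixes `j`.
  rcases Nat.lt_or_ge j n with hj | hj
  · rw [O.ext_mul, Function.comp, hd j hj, hu _ (by omega)]
    rcases Nat.le_total (φ.ext j) j with h | h
    · have := φ.ext_monotone h
      rw [min_eq_left h, max_eq_right this]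
    · rw [min_eq_right h, max_eq_left h]
  · simp only [O.ext_of_le _ hj]

lemma O.closure_eq_top : Submonoid.closure (O.pSet n ∪ O.qSet n) = ⊤ := by
  refine eq_top_iff.2 fun φ _ => ?_
  obtain ⟨u, hu, d, hd, rfl, -⟩ := φ.exists_eq_mul
  exact mul_mem (Submonoid.closure_mono Set.subset_union_right hu)
    (Submonoid.closure_mono Set.subset_union_left hd)

end Extension

/-! ### The homomorphism defined by the normal form. -/

section Lift

variable {M : Type*} [Monoid M]

lemma map_mul_of_mem_closure {A : Type*} [Monoid A] {F : A → M} {s : Set A} (h1 : F 1 = 1)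
    (h : ∀ a, ∀ g ∈ s, F (a * g) = F a * F g) {b : A} (hb : b ∈ Submonoid.closure s) (a : A) :
    F (a * b) = F a * F b := by
  induction hb using Submonoid.closure_induction generalizing a with
  | mem g hg => exact h a g hg
  | one => rw [mul_one, h1, mul_one]
  | mul x y _ _ hx hy => rw [← mul_assoc, hy, hx, hy, mul_assoc]

/-- The normal form of `φ` as a word in the elements `p i` and `q i`. -/
def normalForm {n : ℕ} (p q : ℕ → M) (φ : O n) : M :=
  lowerProd p φ.ext n * raiseProd q φ.ext (n + 1)

lemma raiseProd_ext_succ {n : ℕ} (q : ℕ → M) (φ : O n) :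
    raiseProd q φ.ext (n + 1) = raiseProd q φ.ext n := by
  rw [raiseProd, descProd_of_le q (φ.ext_of_le le_rfl).le, mul_one]

lemma normalForm_one {n : ℕ} (p q : ℕ → M) : normalForm p q (1 : O n) = 1 := by
  rw [normalForm, O.ext_one, lowerProd_of_le p (φ := id) fun j _ => le_rfl,
    raiseProd_of_le q (φ := id) fun j _ => le_rfl, one_mul]

namespace SimplicialRelations

variable {n : ℕ} {p q : ℕ → M} (R : SimplicialRelations n p q)
include R

lemma normalForm_mul_p (φ : O n) {i : ℕ} (hi : i + 2 ≤ n) :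
    normalForm p q (φ * O.p i hi) = normalForm p q φ * p i := by
  rw [normalForm, normalForm, O.ext_mul, O.ext_p]
  rcases Nat.lt_or_ge i (φ.ext i) with h | h
  · rw [lowerProd_comp_pMap φ.ext_monotone h, mul_assoc,
      R.raiseProd_mul_p_of_lt φ.ext_monotone (fun _ => φ.ext_lt) (fun _ => φ.ext_of_le) hi h
        (by omega) le_rfl]
  · rw [mul_assoc, R.raiseProd_mul_p_of_le φ.ext_monotone (fun _ => φ.ext_lt)
        (fun _ => φ.ext_of_le) hi h (by omega) le_rfl, ← mul_assoc,
      R.lowerProd_mul_p φ.ext_monotone h hi le_rfl]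

/-- The two parts stand in the order opposite to `normalForm`, because the lowering word either
absorbs `q i` or hands it on to its left, where the raising word can take it. -/
lemma raiseProd_mul_lowerProd_mul_q (φ : O n) {i : ℕ} (hi : i + 2 ≤ n) :
    raiseProd q (φ * O.q i hi).ext n * lowerProd p (φ * O.q i hi).ext n =
      raiseProd q φ.ext n * lowerProd p φ.ext n * q i := by
  rw [O.ext_mul, O.ext_q]
  rcases Nat.lt_or_ge i (φ.ext (i + 1)) with h | h
  · rw [mul_assoc, R.lowerProd_mul_q_of_lt φ.ext_monotone hi h hi le_rfl, ← mul_assoc,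
      R.raiseProd_mul_q φ.ext_monotone (fun _ => φ.ext_lt) hi h hi le_rfl]
  · rw [raiseProd_comp_qMap φ.ext_monotone h, mul_assoc,
      R.lowerProd_mul_q_of_le φ.ext_monotone hi h hi le_rfl]

lemma normalForm_p {i : ℕ} (hi : i + 2 ≤ n) : normalForm p q (O.p i hi) = p i := by
  have := R.normalForm_mul_p 1 hi
  rwa [one_mul, normalForm_one, one_mul] at this

/-- No word-by-word exchange is needed. Factor `φ = u * d` with `u` raising and `d` a product of
`p`'s. Compatibility with right multiplication by the `p i` already gives multiplicativity on `u *
d`, and the normal forms of `u` and `d` are purely raising and purely lowering, which fixes the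
order. -/
lemma normalForm_eq (φ : O n) :
    normalForm p q φ = raiseProd q φ.ext n * lowerProd p φ.ext n := by
  obtain ⟨u, -, d, hd, h, hu', hd'⟩ := φ.exists_eq_mul
  have key : normalForm p q (u * d) = normalForm p q u * normalForm p q d := by
    refine map_mul_of_mem_closure (normalForm_one p q) ?_ hd u
    rintro a _ ⟨i, hi, rfl⟩
    rw [R.normalForm_mul_p, R.normalForm_p]
  rw [h, key, ← h, normalForm, normalForm, raiseProd_ext_succ, raiseProd_ext_succ,
    lowerProd_of_le p (φ := u.ext) fun j hj => by rw [hu' j hj]; exact le_max_right _ _,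
    raiseProd_of_le q (φ := d.ext) fun j hj => by rw [hd' j hj]; exact min_le_right _ _,
    one_mul, mul_one]
  congr 1
  · refine raiseProd_congr q fun j hj => ?_
    rw [hu' j hj]
    rcases Nat.le_total (φ.ext j) j with h | h
    · rw [max_eq_right h, descProd_of_le q le_rfl, descProd_of_le q h]
    · rw [max_eq_left h]
  · refine lowerProd_congr p fun j hj => ?_
    rw [hd' j hj]
    rcases Nat.le_total (φ.ext j) j with h | h
    · rw [min_eq_left h]
    · rw [min_eq_right h, ascProd_of_le p le_rfl, ascProd_of_le p h]

lemma normalForm_mul_q (φ : O n) {i : ℕ} (hi : i + 2 ≤ n) :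
    normalForm p q (φ * O.q i hi) = normalForm p q φ * q i := by
  rw [R.normalForm_eq, R.normalForm_eq, R.raiseProd_mul_lowerProd_mul_q]

lemma normalForm_q {i : ℕ} (hi : i + 2 ≤ n) : normalForm p q (O.q i hi) = q i := by
  have := R.normalForm_mul_q 1 hi
  rwa [one_mul, normalForm_one, one_mul] at this

lemma normalForm_mul (φ ψ : O n) :
    normalForm p q (φ * ψ) = normalForm p q φ * normalForm p q ψ := by
  refine map_mul_of_mem_closure (s := O.pSet n ∪ O.qSet n) (normalForm_one p q) ?_
    (by rw [O.closure_eq_top]; trivial) φ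
  rintro a _ (⟨i, hi, rfl⟩ | ⟨i, hi, rfl⟩)
  · rw [R.normalForm_mul_p, R.normalForm_p]
  · rw [R.normalForm_mul_q, R.normalForm_q]

/-- The homomorphism on `O n` determined by elements that satisfy its defining relations. -/
def lift : O n →* M where
  toFun := normalForm p q
  map_one' := normalForm_one p q
  map_mul' := R.normalForm_mul

lemma lift_p {i : ℕ} (hi : i + 2 ≤ n) : R.lift (O.p i hi) = p i := R.normalForm_p hi

lemma lift_q {i : ℕ} (hi : i + 2 ≤ n) : R.lift (O.q i hi) = q i := R.normalForm_q hi

end SimplicialRelations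

end Lift

/-! ### From diagram relations to simplicial relations. -/

section Embedding

variable {M : Type*} [Monoid M]

/-- The relations between the elements `h i`, `1 ≤ i < m`, that do not involve circles. -/
structure DiagramRelations (m : ℕ) (h : ℕ → M) : Prop where
  comm (i j : ℕ) (hj : 1 ≤ j) (hi : i < m) (hji : j + 1 < i) : Commute (h i) (h j)
  up (i : ℕ) (hi : 1 ≤ i) (him : i + 1 < m) : h i * h (i + 1) * h i = h i
  down (i : ℕ) (hi : 1 ≤ i) (him : i + 1 < m) : h (i + 1) * h i * h (i + 1) = h (i + 1)

namespace DiagramRelations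

variable {n : ℕ} {h : ℕ → M} (R : DiagramRelations (2 * n) h)
include R

lemma comm' (i j : ℕ) (hi : 1 ≤ i) (hj : 1 ≤ j) (hin : i < 2 * n) (hjn : j < 2 * n)
    (hij : i + 1 < j ∨ j + 1 < i) : h i * h j = h j * h i :=
  hij.elim (fun hij => (R.comm j i hi hjn hij).symm) fun hji => R.comm i j hj hin hji

lemma commute_mul (a b c d : ℕ) (ha : 1 ≤ a ∧ a < 2 * n) (hb : 1 ≤ b ∧ b < 2 * n)
    (hc : 1 ≤ c ∧ c < 2 * n) (hd : 1 ≤ d ∧ d < 2 * n) (hac : a + 1 < c ∨ c + 1 < a)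
    (had : a + 1 < d ∨ d + 1 < a) (hbc : b + 1 < c ∨ c + 1 < b) (hbd : b + 1 < d ∨ d + 1 < b) :
    Commute (h a * h b) (h c * h d) := by
  have ac : Commute (h a) (h c) := R.comm' a c ha.1 hc.1 ha.2 hc.2 hac
  have ad : Commute (h a) (h d) := R.comm' a d ha.1 hd.1 ha.2 hd.2 had
  have bc : Commute (h b) (h c) := R.comm' b c hb.1 hc.1 hb.2 hc.2 hbc
  have bd : Commute (h b) (h d) := R.comm' b d hb.1 hd.1 hb.2 hd.2 hbd
  exact (ac.mul_right ad).mul_left (bc.mul_right bd)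

/-- Each identity follows from far commutation and from cancelling `h a * h (a ± 1) * h a`. No
square of an `h` ever has to be evaluated, so circles do not enter and one proof serves all three
monoids. -/
lemma simplicialRelations : SimplicialRelations n (fun i => h (2 * i + 3) * h (2 * i + 2))
    (fun i => h (2 * i + 1) * h (2 * i + 2)) where
  p_idem i hi := by
    rw [← mul_assoc, R.down (2 * i + 2) (by omega) (by omega)]
  q_idem i hi := by
    rw [← mul_assoc, R.up (2 * i + 1) (by omega) (by omega)]
  p_mul_q i hi := by
    rw [mul_assoc, ← mul_assoc (h (2 * i + 2)), R.down (2 * i + 1) (by omega) (by omega)]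
  q_mul_p i hi := by
    rw [mul_assoc, ← mul_assoc (h (2 * i + 2)), R.up (2 * i + 2) (by omega) (by omega)]
  p_mul_q_succ i hi := by
    change h (2 * i + 3) * h (2 * i + 2) * (h (2 * i + 3) * h (2 * i + 4)) =
      h (2 * i + 3) * h (2 * i + 4)
    rw [← mul_assoc, R.down (2 * i + 2) (by omega) (by omega)]
  q_succ_mul_p i hi := by
    change h (2 * i + 3) * h (2 * i + 4) * (h (2 * i + 3) * h (2 * i + 2)) =
      h (2 * i + 3) * h (2 * i + 2)
    rw [← mul_assoc, R.up (2 * i + 3) (by omega) (by omega)]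
  p_comm i j hi hji := by
    apply R.commute_mul <;> omega
  q_comm i j hi hji := by
    apply R.commute_mul <;> omega
  q_p_comm i j hi hj h1 h2 := by
    rcases lt_or_gt_of_ne h1 with h | h
    · apply R.commute_mul <;> omega
    · apply R.commute_mul <;> omega
  p_up i hi := by
    change h (2 * i + 3) * h (2 * i + 2) * (h (2 * i + 5) * h (2 * i + 4)) *
      (h (2 * i + 3) * h (2 * i + 2)) =
      h (2 * i + 3) * h (2 * i + 2) * (h (2 * i + 5) * h (2 * i + 4))
    have c : Commute (h (2 * i + 2)) (h (2 * i + 5) * h (2 * i + 4)) := by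
      refine Commute.mul_right ?_ ?_ <;> apply R.comm' <;> omega
    rw [mul_assoc (h (2 * i + 3)), c.eq]
    simp only [mul_assoc]
    rw [← mul_assoc (h (2 * i + 2)) (h (2 * i + 3)), R.up (2 * i + 2) (by omega) (by omega)]
  p_down i hi := by
    change h (2 * i + 5) * h (2 * i + 4) * (h (2 * i + 3) * h (2 * i + 2)) *
      (h (2 * i + 5) * h (2 * i + 4)) =
      h (2 * i + 3) * h (2 * i + 2) * (h (2 * i + 5) * h (2 * i + 4))
    have c : Commute (h (2 * i + 2)) (h (2 * i + 5) * h (2 * i + 4)) := by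
      refine Commute.mul_right ?_ ?_ <;> apply R.comm' <;> omega
    have c' : Commute (h (2 * i + 3)) (h (2 * i + 5)) := by
      apply R.comm' <;> omega
    simp only [mul_assoc]
    rw [c.eq]
    simp only [mul_assoc]
    rw [← mul_assoc (h (2 * i + 3)) (h (2 * i + 5)), c'.eq, mul_assoc (h (2 * i + 5)),
      ← mul_assoc (h (2 * i + 4)) (h (2 * i + 5)), ← mul_assoc (h (2 * i + 5)),
      ← mul_assoc (h (2 * i + 5)), R.down (2 * i + 4) (by omega) (by omega)]
  q_up i hi := by
    change h (2 * i + 1) * h (2 * i + 2) * (h (2 * i + 3) * h (2 * i + 4)) *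
      (h (2 * i + 1) * h (2 * i + 2)) =
      h (2 * i + 3) * h (2 * i + 4) * (h (2 * i + 1) * h (2 * i + 2))
    have c : Commute (h (2 * i + 1)) (h (2 * i + 3) * h (2 * i + 4)) := by
      refine Commute.mul_right ?_ ?_ <;> apply R.comm' <;> omega
    rw [mul_assoc, ← mul_assoc _ (h (2 * i + 1)), ← c.eq]
    simp only [mul_assoc]
    rw [← mul_assoc (h (2 * i + 2)) (h (2 * i + 1)), ← mul_assoc (h (2 * i + 1)),
      ← mul_assoc (h (2 * i + 1)) (h (2 * i + 2)), R.up (2 * i + 1) (by omega) (by omega)]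
  q_down i hi := by
    change h (2 * i + 3) * h (2 * i + 4) * (h (2 * i + 1) * h (2 * i + 2)) *
      (h (2 * i + 3) * h (2 * i + 4)) =
      h (2 * i + 3) * h (2 * i + 4) * (h (2 * i + 1) * h (2 * i + 2))
    have c : Commute (h (2 * i + 4)) (h (2 * i + 1) * h (2 * i + 2)) := by
      refine Commute.mul_right ?_ ?_ <;> apply R.comm' <;> omega
    rw [mul_assoc (h (2 * i + 3)), c.eq]
    simp only [mul_assoc]
    rw [← mul_assoc (h (2 * i + 4)) (h (2 * i + 3)), R.down (2 * i + 3) (by omega) (by omega)]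

end DiagramRelations

/-! ### A faithful action on sets of sequences -/

/-- The operation on sets of sequences that pulls back along precomposition with `σ`. -/
def precomp (σ : ℕ → ℕ) : Function.End (Set (ℕ → ℕ)) := fun S => {x | x ∘ σ ∈ S}

lemma precomp_comp (σ τ : ℕ → ℕ) : precomp (σ ∘ τ) = precomp σ * precomp τ := rfl

lemma precomp_injective : Function.Injective precomp := by
  intro σ τ h
  -- The identity sequence lies in the pullback of the singleton `{τ}` along `σ` exactly when `σ =
  -- τ`.
  have : id ∘ σ ∈ ({id ∘ τ} : Set (ℕ → ℕ)) := by
    change id ∈ precomp σ {id ∘ τ}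
    rw [h]
    rfl
  exact this

/-- The operation on sets of sequences that forgets the term with index `k`. -/
def cut (k : ℕ) : Function.End (Set (ℕ → ℕ)) := fun S => {x | ∃ b, Function.update x k b ∈ S}

/-- The operation on sets of sequences that selects those with equal terms at `k` and `k + 1`. -/
def join (k : ℕ) : Function.End (Set (ℕ → ℕ)) := fun S => {x | x ∈ S ∧ x k = x (k + 1)}

/-- The action of the generator `h^i` on sets of sequences. -/
def diagramAction (i : ℕ) : Function.End (Set (ℕ → ℕ)) :=
  if i % 2 = 1 then cut (i / 2) else join (i / 2 - 1)

lemma diagramAction_odd (k : ℕ) : diagramAction (2 * k + 1) = cut k := by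
  rw [diagramAction, if_pos (by omega)]
  congr 1
  omega

lemma diagramAction_even (k : ℕ) : diagramAction (2 * k + 2) = join k := by
  rw [diagramAction, if_neg (by omega)]
  congr 1
  omega

lemma cut_mul_cut_self (k : ℕ) : cut k * cut k = cut k := by
  funext S
  ext x
  change (∃ b, ∃ b', Function.update (Function.update x k b) k b' ∈ S) ↔
    ∃ b, Function.update x k b ∈ S
  simp

lemma join_mul_join_self (k : ℕ) : join k * join k = join k := by
  funext S
  ext x
  change (x ∈ S ∧ x k = x (k + 1)) ∧ x k = x (k + 1) ↔ x ∈ S ∧ x k = x (k + 1)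
  tauto

lemma commute_cut_cut {k l : ℕ} (h : k ≠ l) : Commute (cut k) (cut l) := by
  funext S
  ext x
  change (∃ b, ∃ b', Function.update (Function.update x k b) l b' ∈ S) ↔
    ∃ b, ∃ b', Function.update (Function.update x l b) k b' ∈ S
  rw [exists_comm]
  simp only [Function.update_comm h]

lemma commute_join_join (k l : ℕ) : Commute (join k) (join l) := by
  funext S
  ext x
  change (x ∈ S ∧ x l = x (l + 1)) ∧ x k = x (k + 1) ↔
    (x ∈ S ∧ x k = x (k + 1)) ∧ x l = x (l + 1)
  tauto

lemma commute_cut_join {k l : ℕ} (h : k ≠ l) (h' : k ≠ l + 1) : Commute (cut k) (join l) := by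
  funext S
  ext x
  change (∃ b, Function.update x k b ∈ S ∧
    Function.update x k b l = Function.update x k b (l + 1)) ↔
    (∃ b, Function.update x k b ∈ S) ∧ x l = x (l + 1)
  simp [Function.update_of_ne h.symm, Function.update_of_ne h'.symm]

/-- The imposed equality forces the quantified coordinate to be `x (k + 1)`, so the existential is a
substitution. -/
lemma cut_mul_join (k : ℕ) : cut k * join k = precomp (qMap k) := by
  funext S
  ext x
  have e : x ∘ qMap k = Function.update x k (x (k + 1)) := by
    funext j
    by_cases h : j = k <;> simp [qMap, h]
  change (∃ b, Function.update x k b ∈ S ∧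
    Function.update x k b k = Function.update x k b (k + 1)) ↔ x ∘ qMap k ∈ S
  simp [e]

lemma cut_succ_mul_join (k : ℕ) : cut (k + 1) * join k = precomp (pMap k) := by
  funext S
  ext x
  have e : x ∘ pMap k = Function.update x (k + 1) (x k) := by
    funext j
    by_cases h : j = k + 1 <;> simp [pMap, h]
  change (∃ b, Function.update x (k + 1) b ∈ S ∧
    Function.update x (k + 1) b k = Function.update x (k + 1) b (k + 1)) ↔ x ∘ pMap k ∈ S
  simp [e]

lemma cut_mul_join_mul_cut (k : ℕ) : cut k * join k * cut k = cut k := by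
  rw [cut_mul_join]
  funext S
  ext x
  have e : x ∘ qMap k = Function.update x k (x (k + 1)) := by
    funext j
    by_cases h : j = k <;> simp [qMap, h]
  change (∃ b, Function.update (x ∘ qMap k) k b ∈ S) ↔ ∃ b, Function.update x k b ∈ S
  simp [e]

lemma cut_succ_mul_join_mul_cut_succ (k : ℕ) : cut (k + 1) * join k * cut (k + 1) = cut (k + 1) := by
  rw [cut_succ_mul_join]
  funext S
  ext x
  have e : x ∘ pMap k = Function.update x (k + 1) (x k) := by
    funext j
    by_cases h : j = k + 1 <;> simp [pMap, h]
  change (∃ b, Function.update (x ∘ pMap k) (k + 1) b ∈ S) ↔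
    ∃ b, Function.update x (k + 1) b ∈ S
  simp [e]

lemma comp_qMap_of_eq {x : ℕ → ℕ} {k : ℕ} (h : x k = x (k + 1)) : x ∘ qMap k = x := by
  funext j
  by_cases hj : j = k <;> simp [qMap, hj, h]

lemma comp_pMap_of_eq {x : ℕ → ℕ} {k : ℕ} (h : x k = x (k + 1)) : x ∘ pMap k = x := by
  funext j
  by_cases hj : j = k + 1 <;> simp [pMap, hj, h]

/-- On sequences whose terms at `k` and `k + 1` agree, the substitution made by `cut k * join k` has
no effect. -/
lemma join_mul_cut_mul_join (k : ℕ) : join k * cut k * join k = join k := by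
  rw [mul_assoc, cut_mul_join]
  funext S
  ext x
  exact and_congr_left fun h => by
    change x ∘ qMap k ∈ S ↔ x ∈ S
    rw [comp_qMap_of_eq h]

lemma join_mul_cut_succ_mul_join (k : ℕ) : join k * cut (k + 1) * join k = join k := by
  rw [mul_assoc, cut_succ_mul_join]
  funext S
  ext x
  exact and_congr_left fun h => by
    change x ∘ pMap k ∈ S ↔ x ∈ S
    rw [comp_pMap_of_eq h]

lemma exists_odd_or_even {i : ℕ} (hi : 1 ≤ i) : (∃ k, i = 2 * k + 1) ∨ ∃ k, i = 2 * k + 2 := by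
  rcases Nat.even_or_odd' i with ⟨k, rfl | rfl⟩
  · exact Or.inr ⟨k - 1, by omega⟩
  · exact Or.inl ⟨k, rfl⟩

lemma diagramAction_mul_self {i : ℕ} (hi : 1 ≤ i) :
    diagramAction i * diagramAction i = diagramAction i := by
  obtain ⟨k, rfl⟩ | ⟨k, rfl⟩ := exists_odd_or_even hi
  · rw [diagramAction_odd, cut_mul_cut_self]
  · rw [diagramAction_even, join_mul_join_self]

lemma diagramAction_relations (m : ℕ) : DiagramRelations m diagramAction where
  comm i j hj hi hji := by
    obtain ⟨k, rfl⟩ | ⟨k, rfl⟩ := exists_odd_or_even (by omega : 1 ≤ i) <;>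
      obtain ⟨l, rfl⟩ | ⟨l, rfl⟩ := exists_odd_or_even hj <;>
      simp only [diagramAction_odd, diagramAction_even]
    · exact commute_cut_cut (by omega)
    · exact commute_cut_join (by omega) (by omega)
    · exact (commute_cut_join (by omega) (by omega)).symm
    · exact commute_join_join k l
  up i hi him := by
    obtain ⟨k, rfl⟩ | ⟨k, rfl⟩ := exists_odd_or_even hi
    · rw [diagramAction_odd, diagramAction_even, cut_mul_join_mul_cut]
    · rw [diagramAction_even, show 2 * k + 2 + 1 = 2 * (k + 1) + 1 by omega, diagramAction_odd,
        join_mul_cut_succ_mul_join]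
  down i hi him := by
    obtain ⟨k, rfl⟩ | ⟨k, rfl⟩ := exists_odd_or_even hi
    · rw [diagramAction_odd, diagramAction_even, join_mul_cut_mul_join]
    · rw [diagramAction_even, show 2 * k + 2 + 1 = 2 * (k + 1) + 1 by omega, diagramAction_odd,
        cut_succ_mul_join_mul_cut_succ]

/-- If the `h i` satisfy the diagram relations and act on sets of sequences by `diagramAction`,
then the homomorphism from `O n` that they determine is injective. -/
theorem DiagramRelations.exists_embedding {n : ℕ} {h : ℕ → M} (R : DiagramRelations (2 * n) h)
    (ρ : M →* Function.End (Set (ℕ → ℕ)))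
    (hρ : ∀ i, 1 ≤ i → i < 2 * n → ρ (h i) = diagramAction i) :
    ∃ f : O n →* M, Function.Injective f ∧ ∀ (i : ℕ) (hi : i + 2 ≤ n),
      f (O.p i hi) = h (2 * i + 3) * h (2 * i + 2) ∧
        f (O.q i hi) = h (2 * i + 1) * h (2 * i + 2) := by
  have S := R.simplicialRelations
  -- Both sides are multiplicative in `φ`, so the generators suffice; there the claim is the
  -- substitution identity for a `cut` followed by a `join`.
  have key (φ : O n) : ρ (S.lift φ) = precomp φ.ext := by
    have hφ : φ ∈ Submonoid.closure (O.pSet n ∪ O.qSet n) := by rw [O.closure_eq_top]; trivial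
    induction hφ using Submonoid.closure_induction with
    | mem g hg =>
      obtain ⟨i, hi, rfl⟩ | ⟨i, hi, rfl⟩ := hg
      · rw [S.lift_p, O.ext_p, map_mul, hρ _ (by omega) (by omega), hρ _ (by omega) (by omega),
          ← cut_succ_mul_join, diagramAction_even, show 2 * i + 3 = 2 * (i + 1) + 1 by omega,
          diagramAction_odd]
      · rw [S.lift_q, O.ext_q, map_mul, hρ _ (by omega) (by omega), hρ _ (by omega) (by omega),
          ← cut_mul_join, diagramAction_even, diagramAction_odd]
    | one => rw [map_one, map_one, O.ext_one]; rfl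
    | mul x y _ _ hx hy => rw [map_mul, map_mul, hx, hy, O.ext_mul, precomp_comp]
  refine ⟨S.lift, fun φ ψ hφψ => O.ext_injective (precomp_injective ?_), fun i hi =>
    ⟨S.lift_p hi, S.lift_q hi⟩⟩
  rw [← key, ← key, hφψ]

end Embedding

/-! ### The three presented monoids and their actions. -/

section Actions

/-- The element `h^i` of `K n`, or `1` if `i` is out of range. -/
def K.gen (n i : ℕ) : K n := if hi : 1 ≤ i ∧ i < n then K.h i hi.1 hi.2 else 1

/-- The element `h^i` of `J n`, or `1` if `i` is out of range. -/
def J.gen (n i : ℕ) : J n := if hi : 1 ≤ i ∧ i < n then J.h i hi.1 hi.2 else 1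

/-- The element `h^i` of `L n`, or `1` if `i` is out of range. -/
def L.gen (n i : ℕ) : L n := if hi : 1 ≤ i ∧ i < n then L.h i hi.1 hi.2 else 1

variable {n : ℕ}

lemma K.gen_eq {i : ℕ} (h1 : 1 ≤ i) (hn : i < n) : K.gen n i = K.h i h1 hn := dif_pos ⟨h1, hn⟩

lemma J.gen_eq {i : ℕ} (h1 : 1 ≤ i) (hn : i < n) : J.gen n i = J.h i h1 hn := dif_pos ⟨h1, hn⟩

lemma L.gen_eq {i : ℕ} (h1 : 1 ≤ i) (hn : i < n) : L.gen n i = L.h i h1 hn := dif_pos ⟨h1, hn⟩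

lemma K.diagramRelations : DiagramRelations n (K.gen n) where
  comm i j hj hi hji := by
    rw [K.gen_eq (by omega) hi, K.gen_eq hj (by omega)]
    exact PresentedMonoid.mk_eq_mk_of_rel (.comm i j _ _ _ _ hji)
  up i hi him := by
    rw [K.gen_eq hi (by omega), K.gen_eq (by omega) him]
    exact PresentedMonoid.mk_eq_mk_of_rel (.up i _ _ _ _)
  down i hi him := by
    rw [K.gen_eq hi (by omega), K.gen_eq (by omega) him]
    exact PresentedMonoid.mk_eq_mk_of_rel (.down i _ _ _ _)

lemma J.diagramRelations : DiagramRelations n (J.gen n) where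
  comm i j hj hi hji := by
    rw [J.gen_eq (by omega) hi, J.gen_eq hj (by omega)]
    exact PresentedMonoid.mk_eq_mk_of_rel (.comm i j _ _ _ _ hji)
  up i hi him := by
    rw [J.gen_eq hi (by omega), J.gen_eq (by omega) him]
    exact PresentedMonoid.mk_eq_mk_of_rel (.up i _ _ _ _)
  down i hi him := by
    rw [J.gen_eq hi (by omega), J.gen_eq (by omega) him]
    exact PresentedMonoid.mk_eq_mk_of_rel (.down i _ _ _ _)

lemma L.diagramRelations : DiagramRelations n (L.gen n) where
  comm i j hj hi hji := by
    rw [L.gen_eq (by omega) hi, L.gen_eq hj (by omega)]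
    exact PresentedMonoid.mk_eq_mk_of_rel (.comm i j _ _ _ _ hji)
  up i hi him := by
    rw [L.gen_eq hi (by omega), L.gen_eq (by omega) him]
    exact PresentedMonoid.mk_eq_mk_of_rel (.up i _ _ _ _)
  down i hi him := by
    rw [L.gen_eq hi (by omega), L.gen_eq (by omega) him]
    exact PresentedMonoid.mk_eq_mk_of_rel (.down i _ _ _ _)

/-- The action of the generators of `K n` and `J n` on sets of sequences: circles act trivially. -/
def Gen.action : Gen n → Function.End (Set (ℕ → ℕ))
  | .h i _ _ => diagramAction i
  | .c => 1

/-- The action of the generators of `L n` on sets of sequences: circles act trivially. -/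
def LGen.action : LGen n → Function.End (Set (ℕ → ℕ))
  | .h i _ _ => diagramAction i
  | .c _ _ _ _ _ => 1

/-- The action of `K n` on sets of sequences. -/
def K.action : K n →* Function.End (Set (ℕ → ℕ)) :=
  PresentedMonoid.lift Gen.action fun a b hab => by
    cases hab with
    | comm i j hi1 hin hj1 hjn hji =>
      simpa [Gen.action] using ((diagramAction_relations n).comm i j hj1 hin hji).eq
    | up i hi1 hin hj1 hjn =>
      simpa [Gen.action] using (diagramAction_relations n).up i hi1 hjn
    | down i hi1 hin hj1 hjn =>
      simpa [Gen.action] using (diagramAction_relations n).down i hi1 hjn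
    | circle_comm i hi1 hin => simp [Gen.action]
    | circle i hi1 hin => simpa [Gen.action] using diagramAction_mul_self hi1

/-- The action of `J n` on sets of sequences. -/
def J.action : J n →* Function.End (Set (ℕ → ℕ)) :=
  PresentedMonoid.lift Gen.action fun a b hab => by
    cases hab with
    | comm i j hi1 hin hj1 hjn hji =>
      simpa [Gen.action] using ((diagramAction_relations n).comm i j hj1 hin hji).eq
    | up i hi1 hin hj1 hjn =>
      simpa [Gen.action] using (diagramAction_relations n).up i hi1 hjn
    | down i hi1 hin hj1 hjn =>
      simpa [Gen.action] using (diagramAction_relations n).down i hi1 hjn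
    | circle_one => simp [Gen.action]
    | idem i hi1 hin => simpa [Gen.action] using diagramAction_mul_self hi1

/-- The action of `L n` on sets of sequences. -/
def L.action : L n →* Function.End (Set (ℕ → ℕ)) :=
  PresentedMonoid.lift LGen.action fun a b hab => by
    cases hab with
    | comm i j hi1 hin hj1 hjn hji =>
      simpa [LGen.action] using ((diagramAction_relations n).comm i j hj1 hin hji).eq
    | up i hi1 hin hj1 hjn =>
      simpa [LGen.action] using (diagramAction_relations n).up i hi1 hjn
    | down i hi1 hin hj1 hjn =>
      simpa [LGen.action] using (diagramAction_relations n).down i hi1 hjn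
    -- With circles acting trivially, enclosing a configuration reduces to idempotence of the action
    -- of `h^i`.
    | circle_enclose i hi1 hin => simpa [LGen.action] using diagramAction_mul_self hi1
    | _ => simp [LGen.action]

end Actions
end TemperleyLieb

theorem mainTheorem6 (n : ℕ) :
    (∃ f : TemperleyLieb.O n →* TemperleyLieb.K (2 * n), Function.Injective f ∧
      ∀ (i : ℕ) (hi : i + 2 ≤ n),
        f (TemperleyLieb.O.p i hi) =
          TemperleyLieb.K.h (2 * i + 3) (by omega) (by omega) *
            TemperleyLieb.K.h (2 * i + 2) (by omega) (by omega) ∧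
        f (TemperleyLieb.O.q i hi) =
          TemperleyLieb.K.h (2 * i + 1) (by omega) (by omega) *
            TemperleyLieb.K.h (2 * i + 2) (by omega) (by omega)) ∧
    (∃ f : TemperleyLieb.O n →* TemperleyLieb.L (2 * n), Function.Injective f ∧
      ∀ (i : ℕ) (hi : i + 2 ≤ n),
        f (TemperleyLieb.O.p i hi) =
          TemperleyLieb.L.h (2 * i + 3) (by omega) (by omega) *
            TemperleyLieb.L.h (2 * i + 2) (by omega) (by omega) ∧
        f (TemperleyLieb.O.q i hi) =
          TemperleyLieb.L.h (2 * i + 1) (by omega) (by omega) *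
            TemperleyLieb.L.h (2 * i + 2) (by omega) (by omega)) ∧
    (∃ f : TemperleyLieb.O n →* TemperleyLieb.J (2 * n), Function.Injective f ∧
      ∀ (i : ℕ) (hi : i + 2 ≤ n),
        f (TemperleyLieb.O.p i hi) =
          TemperleyLieb.J.h (2 * i + 3) (by omega) (by omega) *
            TemperleyLieb.J.h (2 * i + 2) (by omega) (by omega) ∧
        f (TemperleyLieb.O.q i hi) =
          TemperleyLieb.J.h (2 * i + 1) (by omega) (by omega) *
            TemperleyLieb.J.h (2 * i + 2) (by omega) (by omega)) := by
  refine ⟨?_, ?_, ?_⟩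
  · obtain ⟨f, hf, h⟩ := TemperleyLieb.K.diagramRelations.exists_embedding
      (TemperleyLieb.K.action (n := 2 * n)) fun i h1 hn => by
        rw [TemperleyLieb.K.gen_eq h1 hn]; rfl
    refine ⟨f, hf, fun i hi => ?_⟩
    simpa only [TemperleyLieb.K.gen_eq (show 1 ≤ 2 * i + 3 by omega) (by omega : _ < 2 * n),
      TemperleyLieb.K.gen_eq (show 1 ≤ 2 * i + 2 by omega) (by omega : _ < 2 * n),
      TemperleyLieb.K.gen_eq (show 1 ≤ 2 * i + 1 by omega) (by omega : _ < 2 * n)] using h i hi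
  · obtain ⟨f, hf, h⟩ := TemperleyLieb.L.diagramRelations.exists_embedding
      (TemperleyLieb.L.action (n := 2 * n)) fun i h1 hn => by
        rw [TemperleyLieb.L.gen_eq h1 hn]; rfl
    refine ⟨f, hf, fun i hi => ?_⟩
    simpa only [TemperleyLieb.L.gen_eq (show 1 ≤ 2 * i + 3 by omega) (by omega : _ < 2 * n),
      TemperleyLieb.L.gen_eq (show 1 ≤ 2 * i + 2 by omega) (by omega : _ < 2 * n),
      TemperleyLieb.L.gen_eq (show 1 ≤ 2 * i + 1 by omega) (by omega : _ < 2 * n)] using h i hi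
  · obtain ⟨f, hf, h⟩ := TemperleyLieb.J.diagramRelations.exists_embedding
      (TemperleyLieb.J.action (n := 2 * n)) fun i h1 hn => by
        rw [TemperleyLieb.J.gen_eq h1 hn]; rfl
    refine ⟨f, hf, fun i hi => ?_⟩
    simpa only [TemperleyLieb.J.gen_eq (show 1 ≤ 2 * i + 3 by omega) (by omega : _ < 2 * n),
      TemperleyLieb.J.gen_eq (show 1 ≤ 2 * i + 2 by omega) (by omega : _ < 2 * n),
      TemperleyLieb.J.gen_eq (show 1 ≤ 2 * i + 1 by omega) (by omega : _ < 2 * n)] using h i hi
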